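/- Let $X_1, X_2, \ldots$ be independent random variables, each uniformly distributed on $[0,1]$. For real $t \ge 0$ let $$K_t = \min\{\, n \in \mathbb{N} : X_1 + \cdots + X_n > t \,\} \in \mathbb{N} \cup \{\infty\}, \qquad \min\emptyset = \infty,$$ be the number of draws until the sum exceeds $t$, and let $M(t) = \mathbb{E}[K_t]$ be its expected value. Then $M(t)$ is finite for every $t \ge 0$, and $$M(t) = 2t + \tfrac{2}{3} + o(1) \qquad (t \to \infty,\ t \in \mathbb{R}).$$ -/

import Mathlib

open MeasureTheory ProbabilityTheory Filter Asymptotics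
open scoped ENNReal

/-- The number of terms of `x 0, x 1, …` that must be added until the sum exceeds `t`: the least `n`
with `x 0 + ⋯ + x (n - 1) > t`, and `∞` if there is no such `n`. -/
noncomputable def numDraws (x : ℕ → ℝ) (t : ℝ) : ℕ∞ :=
  sInf {N : ℕ∞ | ∃ n : ℕ, N = n ∧ t < ∑ i ∈ Finset.range n, x i}

/-- The expected number, in `[0, ∞]`, of draws `X 0, X 1, …` until their sum exceeds `t`. -/
noncomputable def expectedDraws {Ω : Type*} [MeasurableSpace Ω] (μ : Measure Ω)
    (X : ℕ → Ω → ℝ) (t : ℝ) : ℝ≥0∞ :=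
  ∫⁻ ω, ((numDraws (fun i => X i ω) t : ℕ∞) : ℝ≥0∞) ∂μ


/-! Since the draws are nonnegative, the number of draws is the number of `n ≥ 0` whose partial sum
is at most `t`, so `M t` is the renewal function of the uniform law. A Chernoff bound with the
Laplace transform at `1` makes it finite, and conditioning on the last draw gives the renewal
equation `M t = 1 + ∫ s in (t - 1)..t, M s` for `t ≥ 0`.

As `∫ s in (t - 1)..t, 2 * s = 2 * t - 1`, the function `f t = M t - 2 * t` equals its own average
over `[t - 1, t]` for `t ≥ 1`. For such a function the moment of `f` over the window, with weight
`s - (t - 1)`, does not depend on `t`. Centring `f` at twice this moment and subtracting the moment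
from the averaging equation leaves a weight of mass `1 / 2`, so the deviation is halved from one
unit window to the next and `f` converges. On `[0, 1]` the renewal equation reads
`M t = 1 + ∫ s in 0..t, M s`, and an integration by parts evaluates the moment of `M` to `1`; that
of `f` is `1 - 2 / 3`, whence the limit `2 / 3`. -/

section MovingAverage

/-- `f` is, from time `1` on, its own average over the unit window just past. Nothing is asked
before time `1`, so the values of `f` on `[0, 1]` are the initial data. -/
def IsUnitMovingAverage (f : ℝ → ℝ) : Prop :=
  ∀ t, 1 ≤ t → f t = ∫ s in (t - 1)..t, f s

theorem hasDerivAt_integral_window {f : ℝ → ℝ} (hf : Continuous f) (a t : ℝ) :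
    HasDerivAt (fun t => ∫ s in (t - a)..t, f s) (f t - f (t - a)) t := by
  have hprimitive (u : ℝ) := (hf.integral_hasStrictDerivAt 0 u).hasDerivAt
  refine ((hprimitive t).sub ((hprimitive (t - a)).comp_sub_const t a)).congr_of_eventuallyEq
    (.of_forall fun u => ?_)
  exact (intervalIntegral.integral_interval_sub_left (hf.intervalIntegrable _ _)
    (hf.intervalIntegrable _ _)).symm

theorem hasDerivAt_integral_window_moment {f : ℝ → ℝ} (hf : Continuous f) (a t : ℝ) :
    HasDerivAt (fun t => ∫ s in (t - a)..t, (s - (t - a)) * f s)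
      (a * f t - ∫ s in (t - a)..t, f s) t := by
  have hsplit : (fun t => ∫ s in (t - a)..t, (s - (t - a)) * f s) =
      fun t => (∫ s in (t - a)..t, s * f s) - (t - a) * ∫ s in (t - a)..t, f s := by
    ext t
    rw [← intervalIntegral.integral_const_mul, ← intervalIntegral.integral_sub
      (Continuous.intervalIntegrable (by fun_prop) _ _)
      (Continuous.intervalIntegrable (by fun_prop) _ _)]
    simp only [sub_mul]
  rw [hsplit]
  refine ((hasDerivAt_integral_window (continuous_id.mul hf) a t).sub
    (((hasDerivAt_id t).sub_const a).mul (hasDerivAt_integral_window hf a t))).congr_deriv ?_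
  simp only [id, Pi.mul_apply]
  ring

theorem integral_window_sub_mul_const (t B : ℝ) : ∫ s in (t - 1)..t, (t - s) * B = B / 2 := by
  rw [intervalIntegral.integral_mul_const, intervalIntegral.integral_comp_sub_left (fun s => s)]
  simp only [sub_self, sub_sub_cancel, integral_id]
  ring

namespace IsUnitMovingAverage

variable {f : ℝ → ℝ} {c : ℝ}

theorem window_moment_eq (hf : Continuous f) (havg : IsUnitMovingAverage f) {t : ℝ} (ht : 1 ≤ t) :
    ∫ s in (t - 1)..t, (s - (t - 1)) * f s = ∫ s in (0 : ℝ)..1, s * f s := by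
  have hderiv (u : ℝ) := hasDerivAt_integral_window_moment hf 1 u
  have hconst := constant_of_has_deriv_right_zero (a := 1) (b := t)
    (fun u _ => (hderiv u).continuousAt.continuousWithinAt)
    (fun u hu => by simpa [← havg u hu.1] using (hderiv u).hasDerivWithinAt)
  simpa using hconst t ⟨ht, le_rfl⟩

/-- Subtracting the conserved moment replaces the uniform weight on the window, of mass `1`, by a
triangular one, of mass `1 / 2`. -/
theorem sub_eq_integral_mul_sub (hf : Continuous f) (havg : IsUnitMovingAverage f)
    (hc : 2 * ∫ s in (0 : ℝ)..1, s * f s = c) {t : ℝ} (ht : 1 ≤ t) :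
    f t - c = ∫ s in (t - 1)..t, (t - s) * (f s - c) := by
  have hmoment := havg.window_moment_eq hf ht
  have hsplit : ∫ s in (t - 1)..t, (t - s) * (f s - c) =
      (∫ s in (t - 1)..t, f s) - (∫ s in (t - 1)..t, (s - (t - 1)) * f s) -
        ∫ s in (t - 1)..t, (t - s) * c := by
    repeat rw [← intervalIntegral.integral_sub (Continuous.intervalIntegrable (by fun_prop) _ _)
      (Continuous.intervalIntegrable (by fun_prop) _ _)]
    congr 1 with s
    ring
  rw [hsplit, ← havg t ht, hmoment, integral_window_sub_mul_const]
  linarith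

theorem abs_sub_le_half (hf : Continuous f) (havg : IsUnitMovingAverage f)
    (hc : 2 * ∫ s in (0 : ℝ)..1, s * f s = c) {t B : ℝ} (ht : 1 ≤ t)
    (hB : ∀ s ∈ Set.Icc (t - 1) t, |f s - c| ≤ B) : |f t - c| ≤ B / 2 := by
  rw [havg.sub_eq_integral_mul_sub hf hc ht, ← integral_window_sub_mul_const t,
    ← Real.norm_eq_abs]
  refine intervalIntegral.norm_integral_le_of_norm_le (by linarith) (.of_forall fun s hs => ?_) ?_
  · have hweight : 0 ≤ t - s := by linarith [hs.2]
    rw [norm_mul, Real.norm_of_nonneg hweight]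
    exact mul_le_mul_of_nonneg_left (hB s ⟨hs.1.le, hs.2⟩) hweight
  · exact Continuous.intervalIntegrable (by fun_prop) _ _

theorem abs_sub_le_half_of_mem_Icc (hf : Continuous f) (havg : IsUnitMovingAverage f)
    (hc : 2 * ∫ s in (0 : ℝ)..1, s * f s = c) {a B : ℝ} (ha : 0 ≤ a)
    (hB : ∀ s ∈ Set.Icc a (a + 1), |f s - c| ≤ B) {t : ℝ} (ht : t ∈ Set.Icc (a + 1) (a + 2)) :
    |f t - c| ≤ B / 2 := by
  have hcont : Continuous fun s => |f s - c| := by fun_prop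
  obtain ⟨m, hm, hmax⟩ := (isCompact_Icc (a := a) (b := a + 2)).exists_isMaxOn
    (Set.nonempty_Icc.2 (by linarith)) hcont.continuousOn
  have hmax : ∀ s ∈ Set.Icc a (a + 2), |f s - c| ≤ |f m - c| := fun s hs => hmax hs
  have hwindow {r : ℝ} (hr : r ∈ Set.Icc (a + 1) (a + 2)) {C : ℝ}
      (hC : ∀ s ∈ Set.Icc a (a + 2), |f s - c| ≤ C) : |f r - c| ≤ C / 2 :=
    havg.abs_sub_le_half hf hc (by linarith [hr.1]) fun s hs =>
      hC s ⟨by linarith [hr.1, hs.1], hs.2.trans hr.2⟩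
  -- A maximum over both windows attained on the second one is at most half of itself, hence zero.
  have hmB : |f m - c| ≤ B := by
    rcases le_total m (a + 1) with hm_fst | hm_snd
    · exact hB m ⟨hm.1, hm_fst⟩
    · have hhalf := hwindow ⟨hm_snd, hm.2⟩ hmax
      have hBa := hB a (by simp)
      linarith [abs_nonneg (f a - c), abs_nonneg (f m - c)]
  exact hwindow ht fun s hs => (hmax s hs).trans hmB

theorem exists_abs_sub_le_mul_pow (hf : Continuous f) (havg : IsUnitMovingAverage f)
    (hc : 2 * ∫ s in (0 : ℝ)..1, s * f s = c) :
    ∃ A : ℝ, ∀ t, 0 ≤ t → |f t - c| ≤ A * (1 / 2) ^ ⌊t⌋₊ := by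
  have hcont : Continuous fun s => f s - c := by fun_prop
  obtain ⟨A, hA⟩ := (isCompact_Icc (a := (0 : ℝ)) (b := 1)).exists_bound_of_continuousOn
    hcont.continuousOn
  have hbound (n : ℕ) : ∀ s ∈ Set.Icc (n : ℝ) (n + 1), |f s - c| ≤ A * (1 / 2) ^ n := by
    induction n with
    | zero => simpa using hA
    | succ n ih =>
      intro s hs
      push_cast [add_assoc, one_add_one_eq_two] at hs
      have := havg.abs_sub_le_half_of_mem_Icc hf hc n.cast_nonneg ih hs
      rw [pow_succ]
      linarith
  exact ⟨A, fun t ht => hbound _ t ⟨Nat.floor_le ht, (Nat.lt_floor_add_one t).le⟩⟩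

theorem tendsto_atTop (hf : Continuous f) (havg : IsUnitMovingAverage f) :
    Tendsto f atTop (nhds (2 * ∫ s in (0 : ℝ)..1, s * f s)) := by
  obtain ⟨A, hA⟩ := havg.exists_abs_sub_le_mul_pow hf rfl
  have hpow : Tendsto (fun t : ℝ => A * (1 / 2 : ℝ) ^ ⌊t⌋₊) atTop (nhds 0) := by
    simpa using ((tendsto_pow_atTop_nhds_zero_of_lt_one (by norm_num : (0 : ℝ) ≤ 1 / 2)
      (by norm_num)).comp (tendsto_nat_floor_atTop (α := ℝ))).const_mul A
  exact tendsto_sub_nhds_zero_iff.1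
    (squeeze_zero_norm' ((eventually_ge_atTop 0).mono hA) hpow)

end IsUnitMovingAverage

end MovingAverage

section UnitRenewalEquation

theorem integral_mul_eq_of_eq_add_integral {g : ℝ → ℝ} {a : ℝ} (hg : Continuous g)
    (h : ∀ t ∈ Set.Icc (0 : ℝ) 1, g t = a + ∫ s in (0 : ℝ)..t, g s) :
    ∫ s in (0 : ℝ)..1, s * g s = a := by
  have hparts := intervalIntegral.integral_mul_deriv_eq_deriv_mul (a := 0) (b := 1)
    (fun s _ => hasDerivAt_id s) (fun s _ => (hg.integral_hasStrictDerivAt 0 s).hasDerivAt)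
    (by simp) (hg.intervalIntegrable _ _)
  have hprimitive : ∫ t in (0 : ℝ)..1, ∫ s in (0 : ℝ)..t, g s = (∫ t in (0 : ℝ)..1, g t) - a := by
    calc ∫ t in (0 : ℝ)..1, ∫ s in (0 : ℝ)..t, g s = ∫ t in (0 : ℝ)..1, (g t - a) := by
          refine intervalIntegral.integral_congr fun t ht => ?_
          rw [Set.uIcc_of_le zero_le_one] at ht
          exact eq_sub_of_add_eq' (h t ht).symm
      _ = (∫ t in (0 : ℝ)..1, g t) - a := by
          rw [intervalIntegral.integral_sub (hg.intervalIntegrable _ _) (by simp)]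
          simp
  simpa [hprimitive] using hparts

/-- `M` solves the renewal equation `M t = 1 + ∫ y in 0..1, M (t - y)` (`t ≥ 0`) of the uniform
distribution on `[0, 1]`, written over the window `[t - 1, t]`, with `M = 0` before time `0`. -/
structure IsUnitRenewal (M : ℝ → ℝ) : Prop where
  intervalIntegrable (a b : ℝ) : IntervalIntegrable M volume a b
  eq_zero_of_neg (t : ℝ) : t < 0 → M t = 0
  eq_one_add_integral (t : ℝ) : 0 ≤ t → M t = 1 + ∫ s in (t - 1)..t, M s

namespace IsUnitRenewal

variable {M : ℝ → ℝ}

/-- `M` jumps at `0`; this is the continuous function that agrees with it on `[0, ∞)`. -/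
noncomputable def continuousExtension (M : ℝ → ℝ) (t : ℝ) : ℝ :=
  1 + ∫ s in (t - 1)..t, M s

theorem continuous_continuousExtension (hM : IsUnitRenewal M) :
    Continuous (continuousExtension M) := by
  have hprimitive := intervalIntegral.continuous_primitive hM.intervalIntegrable 0
  have hwindow (t : ℝ) : continuousExtension M t =
      1 + ((∫ s in (0 : ℝ)..t, M s) - ∫ s in (0 : ℝ)..(t - 1), M s) := by
    rw [continuousExtension, intervalIntegral.integral_interval_sub_left
      (hM.intervalIntegrable _ _) (hM.intervalIntegrable _ _)]
  rw [funext hwindow]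
  exact continuous_const.add (hprimitive.sub (hprimitive.comp (continuous_sub_right 1)))

theorem integral_continuousExtension (hM : IsUnitRenewal M) {a b : ℝ} (ha : 0 ≤ a) (hab : a ≤ b) :
    ∫ s in a..b, continuousExtension M s = ∫ s in a..b, M s := by
  refine intervalIntegral.integral_congr fun s hs => ?_
  rw [Set.uIcc_of_le hab] at hs
  exact (hM.eq_one_add_integral s (ha.trans hs.1)).symm

theorem integral_mul_continuousExtension (hM : IsUnitRenewal M) :
    ∫ s in (0 : ℝ)..1, s * continuousExtension M s = 1 := by
  refine integral_mul_eq_of_eq_add_integral hM.continuous_continuousExtension fun t ht => ?_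
  have hneg : ∫ s in (t - 1)..0, M s = 0 := by
    rw [intervalIntegral.integral_of_le (by linarith [ht.2]), integral_Ioc_eq_integral_Ioo]
    exact setIntegral_eq_zero_of_forall_eq_zero fun s hs => hM.eq_zero_of_neg s hs.2
  rw [hM.integral_continuousExtension le_rfl ht.1, continuousExtension,
    ← intervalIntegral.integral_add_adjacent_intervals (hM.intervalIntegrable _ 0)
      (hM.intervalIntegrable _ _), hneg, zero_add]

theorem isUnitMovingAverage_sub (hM : IsUnitRenewal M) :
    IsUnitMovingAverage fun t => continuousExtension M t - 2 * t := by
  intro t ht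
  rw [intervalIntegral.integral_sub (hM.continuous_continuousExtension.intervalIntegrable _ _)
    (Continuous.intervalIntegrable (by fun_prop) _ _),
    hM.integral_continuousExtension (by linarith) (by linarith),
    intervalIntegral.integral_const_mul, integral_id]
  simp only [continuousExtension]
  ring

theorem integral_mul_continuousExtension_sub (hM : IsUnitRenewal M) :
    ∫ s in (0 : ℝ)..1, s * (continuousExtension M s - 2 * s) = 1 / 3 := by
  have hcont := hM.continuous_continuousExtension
  calc ∫ s in (0 : ℝ)..1, s * (continuousExtension M s - 2 * s)
      = (∫ s in (0 : ℝ)..1, s * continuousExtension M s) - ∫ s in (0 : ℝ)..1, 2 * s ^ 2 := by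
        rw [← intervalIntegral.integral_sub (Continuous.intervalIntegrable (by fun_prop) _ _)
          (Continuous.intervalIntegrable (by fun_prop) _ _)]
        congr 1 with s
        ring
    _ = 1 / 3 := by
        rw [hM.integral_mul_continuousExtension, intervalIntegral.integral_const_mul, integral_pow]
        norm_num

theorem tendsto_sub_nhds_zero (hM : IsUnitRenewal M) :
    Tendsto (fun t => M t - (2 * t + 2 / 3)) atTop (nhds 0) := by
  have hcont := hM.continuous_continuousExtension
  have hlim := hM.isUnitMovingAverage_sub.tendsto_atTop (by fun_prop)
  rw [hM.integral_mul_continuousExtension_sub] at hlim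
  refine (tendsto_sub_nhds_zero_iff.2 hlim).congr' ?_
  filter_upwards [eventually_ge_atTop 0] with t ht
  rw [continuousExtension, ← hM.eq_one_add_integral t ht]
  ring

end IsUnitRenewal

end UnitRenewalEquation

section RenewalFunction

/-- The `n`-fold convolution power of `ν`: the law of a sum of `n` independent variables of
law `ν`. -/
noncomputable def convPower (ν : Measure ℝ) : ℕ → Measure ℝ
  | 0 => Measure.dirac 0
  | n + 1 => convPower ν n ∗ ν

/-- The renewal function of `ν`: the expected number of `n ≥ 0` such that the `n`-th partial sum of
independent variables of law `ν` is at most `t`. The term `n = 0` is counted. -/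
noncomputable def renewalFunction (ν : Measure ℝ) (t : ℝ) : ℝ≥0∞ :=
  ∑' n, convPower ν n (Set.Iic t)

theorem conv_Iic (μ ν : Measure ℝ) [SFinite μ] [SFinite ν] (t : ℝ) :
    (μ ∗ ν) (Set.Iic t) = ∫⁻ y, μ (Set.Iic (t - y)) ∂ν := by
  have hmeas : MeasurableSet ((fun p : ℝ × ℝ => p.1 + p.2) ⁻¹' Set.Iic t) :=
    measurable_add measurableSet_Iic
  rw [Measure.conv, Measure.map_apply measurable_add measurableSet_Iic,
    Measure.prod_apply_symm hmeas]
  refine lintegral_congr fun y => congrArg μ ?_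
  ext x
  simp [le_sub_iff_add_le]

variable {ν : Measure ℝ}

theorem monotone_renewalFunction (ν : Measure ℝ) : Monotone (renewalFunction ν) :=
  fun _ _ hst => ENNReal.tsum_le_tsum fun _ => measure_mono (Set.Iic_subset_Iic.2 hst)

theorem dirac_zero_Iic (t : ℝ) :
    Measure.dirac (0 : ℝ) (Set.Iic t) = if 0 ≤ t then 1 else 0 := by
  simp [Set.indicator_apply]

section Finite

variable [IsFiniteMeasure ν]

instance instIsFiniteMeasureConvPower (n : ℕ) : IsFiniteMeasure (convPower ν n) := by
  induction n with
  | zero => rw [convPower]; infer_instance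
  | succ n ih => rw [convPower]; infer_instance

theorem renewalFunction_eq_add_lintegral (t : ℝ) :
    renewalFunction ν t =
      (if 0 ≤ t then 1 else 0) + ∫⁻ y, renewalFunction ν (t - y) ∂ν := by
  have hmeas (n : ℕ) : Measurable fun y => convPower ν n (Set.Iic (t - y)) :=
    Antitone.measurable fun _ _ hyz => measure_mono (Set.Iic_subset_Iic.2 (by linarith))
  simp only [renewalFunction]
  rw [lintegral_tsum fun n => (hmeas n).aemeasurable, tsum_eq_zero_add' ENNReal.summable]
  simp only [convPower, dirac_zero_Iic, conv_Iic]

theorem convPower_Iic_of_neg (hν : ∀ᵐ y ∂ν, 0 ≤ y) (n : ℕ) {t : ℝ} (ht : t < 0) :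
    convPower ν n (Set.Iic t) = 0 := by
  induction n generalizing t with
  | zero => rw [convPower, dirac_zero_Iic, if_neg ht.not_ge]
  | succ n ih =>
    rw [convPower, conv_Iic, lintegral_congr_ae (g := 0), lintegral_zero_fun]
    filter_upwards [hν] with y hy using ih (by linarith)

theorem renewalFunction_of_neg (hν : ∀ᵐ y ∂ν, 0 ≤ y) {t : ℝ} (ht : t < 0) :
    renewalFunction ν t = 0 := by
  simp only [renewalFunction, convPower_Iic_of_neg hν _ ht, tsum_zero]

theorem convPower_Iic_le_laplace (n : ℕ) (t : ℝ) :
    convPower ν n (Set.Iic t) ≤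
      (∫⁻ y, ENNReal.ofReal (Real.exp (-y)) ∂ν) ^ n * ENNReal.ofReal (Real.exp t) := by
  induction n generalizing t with
  | zero =>
    rw [convPower, dirac_zero_Iic, pow_zero, one_mul]
    split_ifs with ht
    · simpa using ht
    · exact zero_le
  | succ n ih =>
    set q := ∫⁻ y, ENNReal.ofReal (Real.exp (-y)) ∂ν with hq
    calc convPower ν (n + 1) (Set.Iic t)
        = ∫⁻ y, convPower ν n (Set.Iic (t - y)) ∂ν := by rw [convPower, conv_Iic]
      _ ≤ ∫⁻ y, q ^ n * ENNReal.ofReal (Real.exp (t - y)) ∂ν := lintegral_mono fun y => ih (t - y)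
      _ = ∫⁻ y, q ^ n * ENNReal.ofReal (Real.exp t) * ENNReal.ofReal (Real.exp (-y)) ∂ν := by
        simp only [sub_eq_add_neg, Real.exp_add, ENNReal.ofReal_mul (Real.exp_nonneg _), mul_assoc]
      _ = q ^ (n + 1) * ENNReal.ofReal (Real.exp t) := by
        rw [lintegral_const_mul _ (by fun_prop), ← hq]
        ring

theorem renewalFunction_lt_top_of_laplace_lt_one
    (hν : ∫⁻ y, ENNReal.ofReal (Real.exp (-y)) ∂ν < 1) (t : ℝ) : renewalFunction ν t < ∞ := by
  refine (ENNReal.tsum_le_tsum fun n => convPower_Iic_le_laplace n t).trans_lt ?_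
  rw [ENNReal.tsum_mul_right, ENNReal.tsum_geometric]
  exact ENNReal.mul_lt_top (ENNReal.inv_lt_top.2 (tsub_pos_of_lt hν)) ENNReal.ofReal_lt_top

end Finite

theorem laplace_lt_one [IsProbabilityMeasure ν] (hν : ∀ᵐ y ∂ν, 0 ≤ y) (hpos : ν (Set.Ioi 0) ≠ 0) :
    ∫⁻ y, ENNReal.ofReal (Real.exp (-y)) ∂ν < 1 := by
  have hle : ∀ᵐ y ∂ν, ENNReal.ofReal (Real.exp (-y)) ≤ 1 := by
    filter_upwards [hν] with y hy
    simpa using hy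
  calc ∫⁻ y, ENNReal.ofReal (Real.exp (-y)) ∂ν < ∫⁻ _, 1 ∂ν :=
        lintegral_strict_mono_of_ae_le_of_ae_lt_on aemeasurable_const
          ((lintegral_mono_ae hle).trans_lt (by simp)).ne hle hpos
          (.of_forall fun y hy => by simpa using hy)
    _ = 1 := by simp

theorem renewalFunction_lt_top [IsProbabilityMeasure ν] (hν : ∀ᵐ y ∂ν, 0 ≤ y)
    (hpos : ν (Set.Ioi 0) ≠ 0) (t : ℝ) : renewalFunction ν t < ∞ :=
  renewalFunction_lt_top_of_laplace_lt_one (laplace_lt_one hν hpos) t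

end RenewalFunction

section UniformLaw

/-- The uniform probability measure on `[0, 1]`. -/
noncomputable abbrev uniformUnitInterval : Measure ℝ :=
  volume.restrict (Set.Icc 0 1)

instance : IsProbabilityMeasure uniformUnitInterval := ⟨by simp⟩

theorem ae_nonneg_uniformUnitInterval : ∀ᵐ y ∂uniformUnitInterval, 0 ≤ y :=
  ae_restrict_of_forall_mem measurableSet_Icc fun _ hy => hy.1

theorem renewalFunction_uniformUnitInterval_lt_top (t : ℝ) :
    renewalFunction uniformUnitInterval t < ∞ := by
  refine renewalFunction_lt_top ae_nonneg_uniformUnitInterval ?_ t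
  have hIoc : Set.Ioi (0 : ℝ) ∩ Set.Icc 0 1 = Set.Ioc 0 1 := by
    ext y
    simp only [Set.mem_inter_iff, Set.mem_Ioi, Set.mem_Icc, Set.mem_Ioc]
    exact ⟨fun hy => ⟨hy.1, hy.2.2⟩, fun hy => ⟨hy.1, hy.1.le, hy.2⟩⟩
  simp [hIoc]

theorem isUnitRenewal_renewalFunction :
    IsUnitRenewal fun t => (renewalFunction uniformUnitInterval t).toReal := by
  have hmono : Monotone fun t => (renewalFunction uniformUnitInterval t).toReal := fun _ t hst =>
    ENNReal.toReal_mono (renewalFunction_uniformUnitInterval_lt_top t).ne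
      (monotone_renewalFunction _ hst)
  refine ⟨fun _ _ => hmono.intervalIntegrable, fun t ht => ?_, fun t ht => ?_⟩
  · simp [renewalFunction_of_neg ae_nonneg_uniformUnitInterval ht]
  have hfin := renewalFunction_uniformUnitInterval_lt_top
  have hmeas : Measurable fun y => renewalFunction uniformUnitInterval (t - y) :=
    (monotone_renewalFunction _).measurable.comp (measurable_const.sub measurable_id)
  have hwindow : ∫ s in (t - 1)..t, (renewalFunction uniformUnitInterval s).toReal =
      (∫⁻ y, renewalFunction uniformUnitInterval (t - y) ∂uniformUnitInterval).toReal := by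
    rw [← integral_toReal hmeas.aemeasurable (.of_forall fun y => hfin (t - y)),
      integral_Icc_eq_integral_Ioc, ← intervalIntegral.integral_of_le zero_le_one,
      intervalIntegral.integral_comp_sub_left
        (fun s => (renewalFunction uniformUnitInterval s).toReal), sub_zero]
  have hrenewal := renewalFunction_eq_add_lintegral (ν := uniformUnitInterval) t
  rw [if_pos ht] at hrenewal
  have hint : ∫⁻ y, renewalFunction uniformUnitInterval (t - y) ∂uniformUnitInterval ≠ ∞ :=
    ((le_add_left le_rfl).trans_lt (hrenewal ▸ hfin t)).ne
  rw [hwindow, hrenewal, ENNReal.toReal_add ENNReal.one_ne_top hint, ENNReal.toReal_one]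

end UniformLaw

section Draws

theorem numDraws_eq_tsum {x : ℕ → ℝ} (hx : ∀ i, 0 ≤ x i) (t : ℝ) :
    (numDraws x t : ℝ≥0∞) = ∑' n : ℕ, if ∑ i ∈ Finset.range n, x i ≤ t then 1 else 0 := by
  have hmono : Monotone fun n => ∑ i ∈ Finset.range n, x i :=
    (Finset.sum_mono_set_of_nonneg hx).comp Finset.range_mono
  by_cases hexceeds : ∃ n : ℕ, t < ∑ i ∈ Finset.range n, x i
  · classical
    have hnum : numDraws x t = (Nat.find hexceeds : ℕ∞) := by
      refine le_antisymm (sInf_le ⟨_, rfl, Nat.find_spec hexceeds⟩) (le_sInf ?_)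
      rintro _ ⟨n, rfl, hn⟩
      exact_mod_cast Nat.find_min' hexceeds hn
    have hle_iff (n : ℕ) :
        ∑ i ∈ Finset.range n, x i ≤ t ↔ n ∈ Finset.range (Nat.find hexceeds) := by
      rw [Finset.mem_range, Nat.lt_find_iff]
      exact ⟨fun hn m hm => not_lt.2 ((hmono hm).trans hn), fun hn => not_lt.1 (hn n le_rfl)⟩
    simp only [hle_iff]
    rw [hnum, tsum_eq_sum fun n hn => if_neg hn, Finset.sum_congr rfl fun n hn => if_pos hn]
    simp
  · push Not at hexceeds
    have hnum : numDraws x t = ⊤ := by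
      refine sInf_eq_top.2 ?_
      rintro _ ⟨n, rfl, hn⟩
      exact absurd (hexceeds n) hn.not_ge
    simp [hnum, hexceeds]

variable {Ω : Type*} [MeasurableSpace Ω] {μ : Measure Ω} {X : ℕ → Ω → ℝ}

theorem expectedDraws_eq_tsum (hmeas : ∀ i, AEMeasurable (X i) μ)
    (hnonneg : ∀ i, ∀ᵐ ω ∂μ, 0 ≤ X i ω) (t : ℝ) :
    expectedDraws μ X t = ∑' n : ℕ, μ {ω | ∑ i ∈ Finset.range n, X i ω ≤ t} := by
  have hnull (n : ℕ) : NullMeasurableSet {ω | ∑ i ∈ Finset.range n, X i ω ≤ t} μ :=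
    nullMeasurableSet_le (Finset.aemeasurable_fun_sum _ fun i _ => hmeas i) aemeasurable_const
  calc expectedDraws μ X t
      = ∫⁻ ω, ∑' n : ℕ, {ω | ∑ i ∈ Finset.range n, X i ω ≤ t}.indicator (fun _ => 1) ω ∂μ := by
        refine lintegral_congr_ae ?_
        filter_upwards [ae_all_iff.2 hnonneg] with ω hω
        simp [numDraws_eq_tsum hω, Set.indicator_apply]
    _ = ∑' n : ℕ, μ {ω | ∑ i ∈ Finset.range n, X i ω ≤ t} := by
        rw [lintegral_tsum fun n => (aemeasurable_const (b := (1 : ℝ≥0∞))).indicator₀ (hnull n)]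
        exact tsum_congr fun n => lintegral_indicator_one₀ (hnull n)

variable {ν : Measure ℝ}

theorem hasLaw_sum_range_convPower (hindep : iIndepFun X μ)
    (hlaw : ∀ i, HasLaw (X i) ν μ) (n : ℕ) :
    HasLaw (∑ i ∈ Finset.range n, X i) (convPower ν n) μ := by
  have := hindep.isProbabilityMeasure
  have : IsProbabilityMeasure ν := (hlaw 0).isProbabilityMeasure_iff.1 this
  induction n with
  | zero => exact ⟨aemeasurable_const, by simp [convPower, Pi.zero_def]⟩
  | succ n ih =>
    rw [Finset.sum_range_succ]
    exact (hindep.indepFun_sum_range_succ₀ (fun i => (hlaw i).aemeasurable) n).hasLaw_add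
      ih (hlaw n)

theorem expectedDraws_eq_renewalFunction (hindep : iIndepFun X μ)
    (hlaw : ∀ i, HasLaw (X i) ν μ) (hν : ∀ᵐ y ∂ν, 0 ≤ y) (t : ℝ) :
    expectedDraws μ X t = renewalFunction ν t := by
  have hnonneg (i : ℕ) : ∀ᵐ ω ∂μ, 0 ≤ X i ω :=
    ae_of_ae_map (p := fun y => 0 ≤ y) (hlaw i).aemeasurable (by rwa [(hlaw i).map_eq])
  rw [expectedDraws_eq_tsum (fun i => (hlaw i).aemeasurable) hnonneg, renewalFunction]
  refine tsum_congr fun n => ?_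
  simpa [Set.Iic] using
    (hasLaw_sum_range_convPower hindep hlaw n).measure_eq (p := (· ≤ t)) measurableSet_Iic

theorem hasLaw_uniformUnitInterval_of_isUniform {Y : Ω → ℝ}
    (hY : pdf.IsUniform Y (Set.Icc (0 : ℝ) 1) μ volume) : HasLaw Y uniformUnitInterval μ where
  aemeasurable := pdf.IsUniform.aemeasurable (by simp) (by simp) hY
  map_eq := by
    rw [hY, ProbabilityTheory.cond]
    simp

end Draws

theorem mainTheorem3 {Ω : Type*} [MeasurableSpace Ω] (μ : Measure Ω) [IsProbabilityMeasure μ]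
    (X : ℕ → Ω → ℝ) (hX_indep : iIndepFun X μ)
    (hX_unif : ∀ i, pdf.IsUniform (X i) (Set.Icc (0 : ℝ) 1) μ volume) :
    (∀ t : ℝ, 0 ≤ t → expectedDraws μ X t < ∞) ∧
      (fun t : ℝ => (expectedDraws μ X t).toReal - (2 * t + 2 / 3)) =o[atTop]
        (fun _ => (1 : ℝ)) := by
  have hdraws (t : ℝ) : expectedDraws μ X t = renewalFunction uniformUnitInterval t :=
    expectedDraws_eq_renewalFunction hX_indep
      (fun i => hasLaw_uniformUnitInterval_of_isUniform (hX_unif i))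
      ae_nonneg_uniformUnitInterval t
  simp only [hdraws]
  exact ⟨fun t _ => renewalFunction_uniformUnitInterval_lt_top t,
    (isLittleO_one_iff ℝ).2 isUnitRenewal_renewalFunction.tendsto_sub_nhds_zero⟩
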